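/- Let $q$ be a prime power with $q\equiv 3 \pmod 4$, and let $\delta$ be a primitive $2(q^2+1)$-th root of unity in $\mathrm{GF}(q^4)$. For an integer $i\ge 0$ let $g'_i(x)$ be the minimal polynomial of $\delta^i$ over $\mathrm{GF}(q^2)$. Let $\mathcal C(1,q^2-q+1)$ be the negacyclic code of length $n=q^2+1$ over $\mathrm{GF}(q^2)$ with check polynomial $h(x)=g'_1(x)\,g'_{q^2-q+1}(x)$, that is, the set of all $(c_0,\dots,c_{n-1})\in \mathrm{GF}(q^2)^n$ such that $c_0+c_1x+\cdots+c_{n-1}x^{n-1}$ lies in the ideal of $\mathrm{GF}(q^2)[x]/(x^n+1)$ generated by $(x^n+1)/h(x)$. Let $$D=\mathcal C(1,q^2-q+1)\big|_{\mathrm{GF}(q)}=\mathcal C(1,q^2-q+1)\cap \mathrm{GF}(q)^n$$ be its subfield subcode over $\mathrm{GF}(q)$. Then $D$ is negacyclic (that is, $(c_0,\dots,c_{n-1})\in D$ implies $(-c_{n-1},c_0,\dots,c_{n-2})\in D$), and it is a linear code over $\mathrm{GF}(q)$ with parameters $[q^2+1,4,q^2-q]$ (length, dimension, minimum Hamming distance),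 that is, an ovoid code. Its weight enumerator $\sum_{i=0}^{n}A_i z^i$, where $A_i$ is the number of codewords of Hamming weight $i$, is $$1+(q^2-q)(q^2+1)z^{q^2-q}+(q-1)(q^2+1)z^{q^2}.$$ The dual code of $D$ with respect to the standard inner product has parameters $[q^2+1,q^2-3,4]$. -/

import Mathlib

open Polynomial

/-! # Linear codes of length `n` over a field `F`, as subspaces of `Fin n → F` -/

/-- The code `C` of length `n` has parameters `[n, k, d]`: dimension `k`, and `d` is the least
Hamming distance between two distinct codewords. -/
def HasParameters {F : Type*} [Field F] [DecidableEq F] {n : ℕ}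
    (C : Submodule F (Fin n → F)) (k d : ℕ) : Prop :=
  Module.finrank F C = k ∧
    IsLeast {e : ℕ | ∃ x ∈ C, ∃ y ∈ C, x ≠ y ∧ hammingDist x y = e} d

/-- The number of codewords of Hamming weight `i`. -/
noncomputable def weightCount {F : Type*} [Field F] [DecidableEq F] {n : ℕ}
    (C : Submodule F (Fin n → F)) (i : ℕ) : ℕ :=
  {c : Fin n → F | c ∈ C ∧ hammingNorm c = i}.ncard

/-- The weight enumerator `A₀ + A₁ z + ⋯ + Aₙ zⁿ` as an integer polynomial in `z`. -/
noncomputable def weightEnumerator {F : Type*} [Field F] [DecidableEq F] {n : ℕ}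
    (C : Submodule F (Fin n → F)) : ℤ[X] :=
  ∑ i ∈ Finset.range (n + 1), Polynomial.C (weightCount C i : ℤ) * X ^ i

/-- The dual code with respect to the standard dot product. -/
def dualCode {F : Type*} [Field F] {n : ℕ} (C : Submodule F (Fin n → F)) :
    Submodule F (Fin n → F) where
  carrier := {x | ∀ c ∈ C, x ⬝ᵥ c = 0}
  add_mem' := by
    intro x y hx hy c hc
    rw [add_dotProduct, hx c hc, hy c hc, add_zero]
  zero_mem' := by
    intro c _
    exact zero_dotProduct c
  smul_mem' := by
    intro a x hx c hc
    rw [smul_dotProduct, hx c hc, smul_zero]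

/-- The `lam`-constacyclic shift
`(c₀, c₁, …, cₙ₋₁) ↦ (lam * cₙ₋₁, c₀, …, cₙ₋₂)`. -/
def constacyclicShift {F : Type*} [Field F] {n : ℕ} (lam : F) (c : Fin n → F) : Fin n → F :=
  fun i => if i.val = 0 then lam * c ⟨n - 1, by have := i.isLt; omega⟩
    else c ⟨i.val - 1, by have := i.isLt; omega⟩

/-- `C` is a `lam`-constacyclic code. -/
def IsConstacyclic {F : Type*} [Field F] {n : ℕ} (lam : F) (C : Submodule F (Fin n → F)) : Prop :=
  ∀ c ∈ C, constacyclicShift lam c ∈ C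

/-- A negacyclic code is a `(-1)`-constacyclic code. -/
def IsNegacyclic {F : Type*} [Field F] {n : ℕ} (C : Submodule F (Fin n → F)) : Prop :=
  IsConstacyclic (-1) C

/-- An ovoid code over a finite field with `q > 2` elements is a linear code with parameters
`[q² + 1, 4, q² - q]`. -/
def IsOvoidCode {F : Type*} [Field F] [DecidableEq F] {n : ℕ}
    (C : Submodule F (Fin n → F)) : Prop :=
  2 < Nat.card F ∧ n = Nat.card F ^ 2 + 1 ∧ HasParameters C 4 (Nat.card F ^ 2 - Nat.card F)

/-- The identification
`(c₀, …, cₙ₋₁) ↦ c₀ + c₁ x + ⋯ + cₙ₋₁ xⁿ⁻¹ ∈ K[x] / (xⁿ - lam)`. -/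
noncomputable def codePolynomial {K : Type*} [Field K] (n : ℕ) (lam : K) :
    (Fin n → K) →ₗ[K] AdjoinRoot (X ^ n - C lam : K[X]) :=
  Fintype.linearCombination K
    (fun i : Fin n => AdjoinRoot.root (X ^ n - C lam : K[X]) ^ (i : ℕ))

/-- The `lam`-constacyclic code of length `n` generated by `g`: the vectors whose polynomial lies
in the ideal `(g)` of `K[x] / (xⁿ - lam)`. -/
noncomputable def constacyclicCode {K : Type*} [Field K] (n : ℕ) (lam : K) (g : K[X]) :
    Submodule K (Fin n → K) :=
  ((Ideal.span {AdjoinRoot.mk (X ^ n - C lam : K[X]) g}).restrictScalars K).comap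
    (codePolynomial n lam)

/-- The `lam`-constacyclic code of length `n` with check polynomial `h`, for a monic divisor `h` of
`xⁿ - lam`: its generator polynomial is `(xⁿ - lam) / h`. -/
noncomputable def constacyclicCodeOfCheck {K : Type*} [Field K] (n : ℕ) (lam : K) (h : K[X]) :
    Submodule K (Fin n → K) :=
  constacyclicCode n lam ((X ^ n - C lam) /ₘ h)

/-- The subfield subcode `C ∩ Fⁿ` of a code `C` over an extension field `K` of `F`. -/
def subfieldSubcode (F : Type*) {K : Type*} [Field F] [Field K] [Algebra F K] {n : ℕ}
    (C : Submodule K (Fin n → K)) : Submodule F (Fin n → F) :=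
  (C.restrictScalars F).comap ((Algebra.linearMap F K).compLeft (Fin n))

/-- The negacyclic code `𝒞(i, j)` of length `q² + 1` over `K = GF(q²)` whose check polynomial is the
product of the minimal polynomials over `K` of `δ ^ i` and `δ ^ j`, where `δ` is a primitive
`2(q² + 1)`-th root of unity in `GF(q⁴)`, and `δ ^ i`, `δ ^ j` are not conjugate over `K`
and `i`, `j` are odd. -/
noncomputable def negacyclicFamily (K : Type*) {L : Type*} [Field K] [Field L] [Algebra K L]
    (q : ℕ) (δ : L) (i j : ℕ) : Submodule K (Fin (q ^ 2 + 1) → K) :=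
  constacyclicCodeOfCheck (q ^ 2 + 1) (-1) (minpoly K (δ ^ i) * minpoly K (δ ^ j))

/-! View `L` as a 4-dimensional space over `F`, with Frobenius `σ : x ↦ x ^ q`, and put `ε = δ⁻¹`.
The powers `ε ^ i`, `i ≤ q ^ 2`, are `q ^ 2 + 1` distinct points of `PG(3, q)`. Their norms to
`GF(q²)` are `±1`, hence in `F`; this quadratic condition cuts out an elliptic quadric, so no three
of the points are collinear.

The exponent `q ^ 2 - q + 1` is chosen so that the check polynomial has exactly the four roots `δ, σ
δ, σ² δ, σ³ δ`. By Fourier inversion over the roots of `X ^ n + 1`, `D` is therefore the trace code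
of the words `Tr(a ε ^ i)` (`subfieldSubcode_negacyclicFamily`).

The zeros of such a word are the points of the ovoid in the hyperplane `Tr(a x) = 0`. If `a` is an
`F`-multiple of a power of `ε`, there is exactly one (`zeroCount_traceWord_smul_pow`). For every
other nonzero `a` a second-moment count forces `q + 1` (`zeroCount_of_notMem_ovoidCone`). This gives
both weights and their multiplicities.

Dual words are the `F`-linear relations between the points: none has weight at most 3 because no
three points are collinear, and one of weight 4 exists because some plane contains four points. -/

section FrobeniusOrbits

/-! ### Elements whose relative norm is fixed by Frobenius. -/

variable {L : Type*} [Field L]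

/-- With `s = y + σ² y` the trace condition reads `σ s = -s`. Hence `(y - σ² y)² = s² - 4 y σ² y` is
fixed by `σ`, so `σ` sends `y - σ² y` to plus or minus itself and `σ²` fixes it. But `σ²` also
negates it, so it is zero. -/
theorem map_eq_neg_of_trace_eq_zero (σ : L →+* L) (hσ : ∀ x, σ (σ (σ (σ x))) = x)
    (h2 : (2 : L) ≠ 0) {y : L} (hN : σ (y * σ (σ y)) = y * σ (σ y))
    (hT : y + σ y + σ (σ y) + σ (σ (σ y)) = 0) : σ y = -y := by
  rw [map_mul] at hN
  have hsq : σ (y - σ (σ y)) ^ 2 = (y - σ (σ y)) ^ 2 := by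
    rw [map_sub]
    linear_combination (σ y + σ (σ (σ y)) - y - σ (σ y)) * hT - 4 * hN
  have hs : σ (σ (y - σ (σ y))) = y - σ (σ y) := by
    rcases sq_eq_sq_iff_eq_or_eq_neg.mp hsq with h | h
    · rw [h, h]
    · rw [h, map_neg, h, neg_neg]
  rw [map_sub, map_sub, hσ] at hs
  have h0 : 2 * (σ (σ y) - y) = 0 := by linear_combination hs
  have hy : σ (σ y) = y := sub_eq_zero.mp ((mul_eq_zero.mp h0).resolve_left h2)
  have h1 : 2 * (σ y + y) = 0 := by
    rw [hy] at hT
    linear_combination hT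
  exact eq_neg_of_add_eq_zero_left ((mul_eq_zero.mp h1).resolve_left h2)

/-- Comparing the norms of `y` and `y + 1` shows that `y + σ² y` is fixed as well. So `σ` permutes
the roots `y, σ² y` of a quadratic with fixed coefficients: `σ y` is `y` or `σ² y`, and either way
`σ y = y`. -/
theorem map_eq_self_of_relative_norms (σ : L →+* L) {y : L}
    (hN : σ (y * σ (σ y)) = y * σ (σ y))
    (hN1 : σ ((y + 1) * σ (σ (y + 1))) = (y + 1) * σ (σ (y + 1))) : σ y = y := by
  simp only [map_mul, map_add, map_one] at hN hN1
  have h : (σ y - y) * (σ y - σ (σ y)) = 0 := by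
    linear_combination σ y * hN1 - (1 + σ y) * hN
  rcases mul_eq_zero.mp h with h | h
  · exact sub_eq_zero.mp h
  · exact (σ.injective (sub_eq_zero.mp h)).symm

end FrobeniusOrbits

/-! ### The base field as the fixed field of Frobenius. -/

section FixedField

variable {F L : Type*} [Field F] [Field L] [Algebra F L] [Finite F]

theorem exists_algebraMap_eq_of_pow_natCard_eq {x : L} (hx : x ^ Nat.card F = x) :
    ∃ f : F, algebraMap F L f = x := by
  classical
  have := Fintype.ofFinite F
  rw [Nat.card_eq_fintype_card] at hx
  have hmonic : (X ^ Fintype.card F - X : F[X]).Monic :=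
    monic_X_pow_sub (by rw [degree_X]; exact_mod_cast Fintype.one_lt_card)
  have hcard : Multiset.card (X ^ Fintype.card F - X : F[X]).roots =
      (X ^ Fintype.card F - X : F[X]).natDegree := by
    rw [FiniteField.roots_X_pow_card_sub_X,
      FiniteField.X_pow_card_sub_X_natDegree_eq _ Fintype.one_lt_card]
    rfl
  have hprod := prod_multiset_X_sub_C_of_monic_of_roots_card_eq hmonic hcard
  rw [FiniteField.roots_X_pow_card_sub_X] at hprod
  have h0 : aeval x (X ^ Fintype.card F - X : F[X]) = 0 := by simp [hx]
  rw [← hprod] at h0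
  change aeval x (∏ a : F, (X - C a)) = 0 at h0
  rw [map_prod, Finset.prod_eq_zero_iff] at h0
  obtain ⟨f, -, hf⟩ := h0
  refine ⟨f, ?_⟩
  rw [map_sub, aeval_X, aeval_C] at hf
  exact (sub_eq_zero.mp hf).symm

theorem pow_natCard_algebraMap (f : F) : algebraMap F L f ^ Nat.card F = algebraMap F L f := by
  have := Fintype.ofFinite F
  rw [← map_pow, Nat.card_eq_fintype_card, FiniteField.pow_card]

theorem exists_frobenius (F L : Type*) [Field F] [Field L] [Algebra F L] [Finite F] :
    ∃ σ : L →ₐ[F] L, ∀ x, σ x = x ^ Nat.card F := by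
  have := Fintype.ofFinite F
  exact ⟨FiniteField.frobeniusAlgHom F L, fun x => by
    rw [Nat.card_eq_fintype_card, FiniteField.coe_frobeniusAlgHom]⟩

end FixedField

/-! ### Counting orthogonal complements for the trace form. -/

section Orthogonal

variable {F L : Type*} [Field F] [Field L] [Algebra F L] [Finite L]

theorem natCard_trace_mul_eq_zero {ι : Type*} [Fintype ι] {v : ι → L}
    (hv : LinearIndependent F v) :
    Nat.card {a : L // ∀ i, Algebra.trace F L (a * v i) = 0} * Nat.card F ^ Fintype.card ι =
      Nat.card L := by
  have : Finite F := Finite.of_injective _ (FaithfulSMul.algebraMap_injective F L)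
  have : Module.Finite F L := inferInstance
  set W := Submodule.span F (Set.range v) with hW
  have hmem : ∀ a : L, (∀ i, Algebra.trace F L (a * v i) = 0) ↔
      a ∈ (Algebra.traceForm F L).orthogonal W := by
    intro a
    rw [LinearMap.BilinForm.mem_orthogonal_iff]
    constructor
    · intro h x hx
      induction hx using Submodule.span_induction with
      | mem x hx =>
        obtain ⟨i, rfl⟩ := hx
        rw [Algebra.traceForm_apply, mul_comm, h]
      | zero => simp
      | add x y _ _ hx hy =>
        rw [map_add, LinearMap.add_apply, hx, hy, add_zero]
      | smul c x _ hx =>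
        rw [map_smul, LinearMap.smul_apply, hx, smul_zero]
    · intro h i
      have := h (v i) (Submodule.subset_span ⟨i, rfl⟩)
      rwa [Algebra.traceForm_apply, mul_comm] at this
  rw [Nat.card_congr (Equiv.subtypeEquivRight hmem)]
  change Nat.card ((Algebra.traceForm F L).orthogonal W) * _ = _
  rw [Module.natCard_eq_pow_finrank (K := F), Module.natCard_eq_pow_finrank (K := F) (V := L),
    ← pow_add]
  congr 1
  have h1 := LinearMap.BilinForm.finrank_orthogonal (traceForm_nondegenerate F L) W
  have h2 : Module.finrank F W = Fintype.card ι := finrank_span_eq_card hv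
  have h3 := Submodule.finrank_le W
  omega

end Orthogonal

/-! ### Arithmetic of the powers of `ε`. -/

/-- `ε` is a primitive `2(q² + 1)`-th root of unity in a field `L` of order `q⁴` over a field `F` of
order `q ≡ 3 (mod 4)`. -/
structure IsOvoidRoot (F : Type*) {L : Type*} [Field F] [Field L] [Algebra F L]
    (q : ℕ) (ε : L) : Prop where
  mod_four : q % 4 = 3
  card_base : Nat.card F = q
  card_top : Nat.card L = q ^ 4
  primitive : IsPrimitiveRoot ε (2 * (q ^ 2 + 1))

namespace IsOvoidRoot

variable {F L : Type*} [Field F] [Field L] [Algebra F L] {q : ℕ} {ε : L}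

theorem two_lt (h : IsOvoidRoot F q ε) : 2 < q := by
  have := h.mod_four
  omega

theorem finite_base (h : IsOvoidRoot F q ε) : Finite F :=
  Nat.finite_of_card_ne_zero (by have := h.two_lt; rw [h.card_base]; omega)

theorem finite_top (h : IsOvoidRoot F q ε) : Finite L :=
  Nat.finite_of_card_ne_zero
    (by have := h.two_lt; rw [h.card_top]; exact pow_ne_zero _ (by omega))

theorem inv (h : IsOvoidRoot F q ε) : IsOvoidRoot F q ε⁻¹ :=
  ⟨h.mod_four, h.card_base, h.card_top, h.primitive.inv⟩

theorem ne_zero (h : IsOvoidRoot F q ε) : ε ≠ 0 :=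
  h.primitive.ne_zero (by positivity)

theorem pow_half (h : IsOvoidRoot F q ε) : ε ^ (q ^ 2 + 1) = -1 := by
  have h1 : (ε ^ (q ^ 2 + 1)) ^ 2 = 1 := by
    rw [← pow_mul, mul_comm, h.primitive.pow_eq_one]
  refine (mul_self_eq_one_iff.mp (by rwa [← sq])).resolve_left ?_
  exact h.primitive.pow_ne_one_of_pos_of_lt (by positivity) (by omega)

theorem two_ne_zero (h : IsOvoidRoot F q ε) : (2 : L) ≠ 0 := by
  intro h2
  refine h.primitive.pow_ne_one_of_pos_of_lt (l := q ^ 2 + 1) (by positivity) (by omega) ?_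
  rw [h.pow_half]
  linear_combination -h2

theorem pow_natCard (h : IsOvoidRoot F q ε) (x : L) : x ^ q ^ 4 = x := by
  have := h.finite_top
  have := Fintype.ofFinite L
  rw [← h.card_top, Nat.card_eq_fintype_card, FiniteField.pow_card]

/-- Since `q ≡ 3 (mod 4)`, `(q - 1) / 2` is odd and hence coprime to `q ^ 2 + 1`; so `2 (q ^ 2 + 1)
∣ k (q - 1)` only when `q ^ 2 + 1 ∣ k`. -/
theorem pow_pow_eq_self_iff (h : IsOvoidRoot F q ε) (k : ℕ) :
    (ε ^ k) ^ q = ε ^ k ↔ q ^ 2 + 1 ∣ k := by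
  obtain ⟨m, rfl⟩ : ∃ m, q = 4 * m + 3 := ⟨q / 4, by have := h.mod_four; omega⟩
  have h0 : ε ^ k ≠ 0 := pow_ne_zero _ h.ne_zero
  have hsplit : (ε ^ k) ^ (4 * m + 3) = ε ^ k * ε ^ (k * (4 * m + 2)) := by
    rw [← pow_mul, ← pow_add]
    ring_nf
  rw [hsplit, mul_eq_left₀ h0, h.primitive.pow_eq_one_iff_dvd,
    show k * (4 * m + 2) = 2 * (k * (2 * m + 1)) by ring,
    Nat.mul_dvd_mul_iff_left two_pos]
  refine Nat.Coprime.dvd_mul_right ?_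
  have h1 : (4 * m + 3) ^ 2 + 1 = 2 + (2 * m + 1) * (8 * m + 8) := by ring
  rw [h1, Nat.coprime_add_mul_left_left]
  exact (Nat.coprime_two_left).mpr ⟨m, rfl⟩

theorem pow_pow_eq_neg_iff (h : IsOvoidRoot F q ε) (k : ℕ) :
    (ε ^ k) ^ q = -ε ^ k ↔ q ^ 2 + 1 ∣ k + (q ^ 2 + 1) / 2 := by
  obtain ⟨m, hm⟩ : ∃ m, q = 4 * m + 3 := ⟨q / 4, by have := h.mod_four; omega⟩
  have hhalf : q ^ 2 + 1 = 2 * ((q ^ 2 + 1) / 2) := by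
    have : q ^ 2 + 1 = 2 * (8 * m ^ 2 + 12 * m + 5) := by rw [hm]; ring
    omega
  set r := (q ^ 2 + 1) / 2 with hr
  have hr0 : ε ^ r ≠ 0 := pow_ne_zero _ h.ne_zero
  -- `ε ^ r` is a square root of `-1`, which Frobenius negates as `q ≡ 3 (mod 4)`. Multiplying by it
  -- turns the sign condition into a fixed-point condition.
  have hrq : (ε ^ r) ^ q = -ε ^ r := by
    have h2 : (ε ^ r) ^ 2 = -1 := by rw [← pow_mul, mul_comm, ← hhalf, h.pow_half]
    rw [hm, pow_add, pow_mul, show (ε ^ r) ^ 4 = ((ε ^ r) ^ 2) ^ 2 by ring,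
      show (ε ^ r) ^ 3 = (ε ^ r) ^ 2 * ε ^ r by ring, h2]
    simp
  rw [← h.pow_pow_eq_self_iff, pow_add, mul_pow, hrq, mul_neg, neg_eq_iff_eq_neg, ← neg_mul,
    mul_left_inj' hr0]

theorem finrank_top (h : IsOvoidRoot F q ε) : Module.finrank F L = 4 := by
  have := h.finite_base
  have := h.finite_top
  have h1 := Module.natCard_eq_pow_finrank (K := F) (V := L)
  rw [h.card_base, h.card_top] at h1
  exact (Nat.pow_right_injective h.two_lt.le h1).symm

theorem exists_frobenius (h : IsOvoidRoot F q ε) :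
    ∃ σ : L →ₐ[F] L, (∀ x, σ x = x ^ q) ∧ (∀ x, σ (σ (σ (σ x))) = x) ∧
      (∀ x, algebraMap F L (Algebra.trace F L x) = x + σ x + σ (σ x) + σ (σ (σ x))) ∧
      ∀ k, σ (ε ^ k * σ (σ (ε ^ k))) = ε ^ k * σ (σ (ε ^ k)) := by
  have := h.finite_base
  have := h.finite_top
  obtain ⟨σ, hσ⟩ := _root_.exists_frobenius F L
  rw [h.card_base] at hσ
  refine ⟨σ, hσ, fun x => ?_, fun x => ?_, fun k => ?_⟩
  · rw [hσ, hσ, hσ, hσ, ← pow_mul, ← pow_mul, ← pow_mul]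
    convert h.pow_natCard x using 2
    ring
  · rw [FiniteField.algebraMap_trace_eq_sum_pow, h.finrank_top, h.card_base]
    simp only [Finset.sum_range_succ, Finset.sum_range_zero, hσ]
    ring
  · have : ε ^ k * σ (σ (ε ^ k)) = (-1) ^ k := by
      rw [hσ, hσ, ← h.pow_half]
      ring
    rw [this, map_pow, map_neg, map_one]

theorem trace_pow_eq_zero_iff (h : IsOvoidRoot F q ε) (k : ℕ) :
    Algebra.trace F L (ε ^ k) = 0 ↔ q ^ 2 + 1 ∣ k + (q ^ 2 + 1) / 2 := by
  obtain ⟨σ, hσ, hσ4, htr, hN⟩ := h.exists_frobenius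
  rw [← h.pow_pow_eq_neg_iff, ← hσ, ← map_eq_zero_iff _ (algebraMap F L).injective, htr]
  constructor
  · exact map_eq_neg_of_trace_eq_zero (σ : L →+* L) hσ4 h.two_ne_zero (hN k)
  · intro e
    simp [e]

/-- Powers of `ε` lying in `F`. -/
theorem dvd_of_pow_eq_algebraMap (h : IsOvoidRoot F q ε) {k : ℕ} {f : F}
    (hf : ε ^ k = algebraMap F L f) : q ^ 2 + 1 ∣ k := by
  have := h.finite_base
  rw [← h.pow_pow_eq_self_iff, hf]
  nth_rewrite 1 [← h.card_base]
  exact pow_natCard_algebraMap f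

theorem eq_of_pow_eq_smul_pow (h : IsOvoidRoot F q ε) {i j : ℕ} (hi : i < q ^ 2 + 1)
    (hj : j < q ^ 2 + 1) {f : F} (hf : f • ε ^ i = ε ^ j) : i = j := by
  have hf0 : f ≠ 0 := by
    rintro rfl
    rw [zero_smul] at hf
    exact pow_ne_zero _ h.ne_zero hf.symm
  wlog hij : i ≤ j generalizing i j f
  · refine (this hj hi (f := f⁻¹) ?_ (inv_ne_zero hf0) (by omega)).symm
    rw [← hf, smul_smul, inv_mul_cancel₀ hf0, one_smul]
  have h1 : ε ^ (j - i) = algebraMap F L f := by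
    have h0 : ε ^ i ≠ 0 := pow_ne_zero _ h.ne_zero
    apply mul_right_cancel₀ h0
    rw [← pow_add, Nat.sub_add_cancel hij, ← hf, Algebra.smul_def]
  have := Nat.eq_zero_of_dvd_of_lt (h.dvd_of_pow_eq_algebraMap h1) (by omega)
  omega

theorem linearIndependent_pow_pair (h : IsOvoidRoot F q ε) {i j : Fin (q ^ 2 + 1)} (hij : i ≠ j) :
    LinearIndependent F ![ε ^ (i : ℕ), ε ^ (j : ℕ)] := by
  rw [LinearIndependent.pair_iff' (pow_ne_zero _ h.ne_zero)]
  intro a ha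
  exact hij (Fin.ext (h.eq_of_pow_eq_smul_pow i.2 j.2 ha))

end IsOvoidRoot

/-! ### No three points of the ovoid are collinear. -/

namespace IsOvoidRoot

variable {F L : Type*} [Field F] [Field L] [Algebra F L] {q : ℕ} {ε : L}

/-- Divide a relation by `v • ε ^ j`: both `y` and `y + 1` become `F`-multiples of quotients of
powers of `ε`, so their relative norms lie in `F`. Then `y ∈ F`, and the points `i` and `j`
coincide. Allowing `w = 0` also covers relations of length two. -/
theorem smul_pow_add_smul_pow_add_smul_pow_ne_zero (h : IsOvoidRoot F q ε) {i j k : ℕ}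
    (hi : i < q ^ 2 + 1) (hj : j < q ^ 2 + 1) (hij : i ≠ j) {u v w : F} (hu : u ≠ 0) (hv : v ≠ 0) :
    u • ε ^ i + v • ε ^ j + w • ε ^ k ≠ 0 := by
  intro hsum
  have := h.finite_base
  obtain ⟨σ, hσ, -, -, hN⟩ := h.exists_frobenius
  have hnorm : ∀ (f : F) (i j : ℕ),
      σ ((algebraMap F L f * ε ^ i * (ε ^ j)⁻¹) *
        σ (σ (algebraMap F L f * ε ^ i * (ε ^ j)⁻¹))) =
      (algebraMap F L f * ε ^ i * (ε ^ j)⁻¹) * σ (σ (algebraMap F L f * ε ^ i * (ε ^ j)⁻¹)) := by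
    intro f i j
    have e : (algebraMap F L f * ε ^ i * (ε ^ j)⁻¹) *
        σ (σ (algebraMap F L f * ε ^ i * (ε ^ j)⁻¹)) =
        algebraMap F L (f ^ 2) * (ε ^ i * σ (σ (ε ^ i))) * (ε ^ j * σ (σ (ε ^ j)))⁻¹ := by
      simp only [map_mul, map_inv₀, AlgHom.commutes, mul_inv, map_pow]
      ring
    rw [e, map_mul, map_mul, map_inv₀, hN, hN, AlgHom.commutes]
  have hj0 : ε ^ j ≠ 0 := pow_ne_zero _ h.ne_zero
  have hv0 : algebraMap F L v ≠ 0 := by simpa using hv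
  set y := algebraMap F L (u / v) * ε ^ i * (ε ^ j)⁻¹ with hy
  have hy1 : y + 1 = algebraMap F L (-w / v) * ε ^ k * (ε ^ j)⁻¹ := by
    simp only [Algebra.smul_def] at hsum
    rw [hy, map_div₀, map_div₀, map_neg]
    field_simp
    linear_combination hsum
  have hfix : (σ : L →+* L) y = y := by
    apply map_eq_self_of_relative_norms
    · exact hnorm _ _ _
    · rw [hy1]
      exact hnorm _ _ _
  have hfix' : y ^ Nat.card F = y := by rw [h.card_base, ← hσ]; exact hfix
  obtain ⟨f, hf⟩ := exists_algebraMap_eq_of_pow_natCard_eq hfix'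
  have hu0 : algebraMap F L u ≠ 0 := by simpa using hu
  refine hij (h.eq_of_pow_eq_smul_pow hj hi (f := f * v / u) ?_).symm
  rw [Algebra.smul_def, map_div₀, map_mul, hf, hy, map_div₀]
  field_simp

theorem eq_zero_of_sum_smul_pow_eq_zero [DecidableEq F] (h : IsOvoidRoot F q ε)
    {c : Fin (q ^ 2 + 1) → F} (hc : ∑ i, c i • ε ^ (i : ℕ) = 0) (hw : hammingNorm c ≤ 3) :
    c = 0 := by
  set s : Finset (Fin (q ^ 2 + 1)) := {i | c i ≠ 0} with hs
  have hmem : ∀ i, i ∈ s ↔ c i ≠ 0 := by simp [hs]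
  have hsum : ∑ i ∈ s, c i • ε ^ (i : ℕ) = 0 := by
    rw [← hc]
    refine Finset.sum_subset (Finset.subset_univ _) fun i _ hi => ?_
    rw [hmem, not_not] at hi
    rw [hi, zero_smul]
  have hcard : s.card ≤ 3 := hw
  have h0 : ∀ i : Fin (q ^ 2 + 1), ε ^ (i : ℕ) ≠ 0 := fun i => pow_ne_zero _ h.ne_zero
  interval_cases hk : s.card
  · rw [Finset.card_eq_zero] at hk
    ext i
    by_contra hi
    have := (hmem i).mpr hi
    simp [hk] at this
  · obtain ⟨i, hi⟩ := Finset.card_eq_one.mp hk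
    have hci : c i ≠ 0 := (hmem i).mp (by simp [hi])
    rw [hi, Finset.sum_singleton] at hsum
    exact absurd hsum (smul_ne_zero hci (h0 i))
  · obtain ⟨i, j, hij, hs'⟩ := Finset.card_eq_two.mp hk
    have hci : c i ≠ 0 := (hmem i).mp (by simp [hs'])
    have hcj : c j ≠ 0 := (hmem j).mp (by simp [hs'])
    rw [hs', Finset.sum_pair hij] at hsum
    refine absurd ?_ (h.smul_pow_add_smul_pow_add_smul_pow_ne_zero (k := 0) i.2 j.2
      (Fin.val_ne_of_ne hij) hci hcj (w := 0))
    rw [hsum, zero_smul, zero_add]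
  · obtain ⟨i, j, k, hij, hik, hjk, hs'⟩ := Finset.card_eq_three.mp hk
    have hci : c i ≠ 0 := (hmem i).mp (by simp [hs'])
    have hcj : c j ≠ 0 := (hmem j).mp (by simp [hs'])
    rw [hs', Finset.sum_insert (by simp [hij, hik]), Finset.sum_pair hjk, ← add_assoc] at hsum
    exact absurd hsum (h.smul_pow_add_smul_pow_add_smul_pow_ne_zero i.2 j.2
      (Fin.val_ne_of_ne hij) hci hcj)

end IsOvoidRoot

/-! ### Trace words and the first two moments of their zero counts. -/

/-- The word `(Tr(a ε⁰), Tr(a ε¹), …, Tr(a εⁿ⁻¹))`. -/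
noncomputable def traceWord (F : Type*) {L : Type*} [Field F] [Field L] [Algebra F L] (n : ℕ)
    (ε : L) : L →ₗ[F] (Fin n → F) :=
  LinearMap.pi fun i => Algebra.trace F L ∘ₗ LinearMap.mulRight F (ε ^ (i : ℕ))

theorem traceWord_apply {F L : Type*} [Field F] [Field L] [Algebra F L] (n : ℕ)
    (ε a : L) (i : Fin n) : traceWord F n ε a i = Algebra.trace F L (a * ε ^ (i : ℕ)) := rfl

/-- The number of zero coordinates of a word. -/
def zeroCount {F : Type*} [Field F] [DecidableEq F] {n : ℕ} (c : Fin n → F) : ℕ :=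
  Finset.card {i | c i = 0}

theorem hammingNorm_add_zeroCount {F : Type*} [Field F] [DecidableEq F] {n : ℕ} (c : Fin n → F) :
    hammingNorm c + zeroCount c = n := by
  have := Finset.card_filter_add_card_filter_not (s := (Finset.univ : Finset (Fin n)))
    (fun i => c i = 0)
  rw [Finset.card_univ, Fintype.card_fin] at this
  rw [add_comm]
  exact this

namespace IsOvoidRoot

variable {F L : Type*} [Field F] [Field L] [Algebra F L] {q : ℕ} {ε : L} [DecidableEq F]

theorem card_traceWord_eq_zero [Fintype L] (h : IsOvoidRoot F q ε) (i : Fin (q ^ 2 + 1)) :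
    Finset.card {a : L | traceWord F (q ^ 2 + 1) ε a i = 0} = q ^ 3 := by
  have h1 := natCard_trace_mul_eq_zero (F := F) (v := fun _ : Fin 1 => ε ^ (i : ℕ))
    (LinearIndependent.of_subsingleton 0 (pow_ne_zero _ h.ne_zero))
  rw [h.card_base, h.card_top, Fintype.card_fin, pow_one] at h1
  rw [← Fintype.card_subtype, ← Nat.card_eq_fintype_card]
  simp only [traceWord_apply]
  have hq := h.two_lt
  refine Nat.eq_of_mul_eq_mul_right (show 0 < q by omega) ?_
  simp only [forall_const] at h1
  rw [h1]
  ring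

theorem card_traceWord_eq_zero_and [Fintype L] (h : IsOvoidRoot F q ε) {i j : Fin (q ^ 2 + 1)}
    (hij : i ≠ j) :
    Finset.card {a : L | traceWord F (q ^ 2 + 1) ε a i = 0 ∧
      traceWord F (q ^ 2 + 1) ε a j = 0} = q ^ 2 := by
  have h1 := natCard_trace_mul_eq_zero (h.linearIndependent_pow_pair hij)
  rw [h.card_base, h.card_top, Fintype.card_fin] at h1
  rw [← Fintype.card_subtype, ← Nat.card_eq_fintype_card]
  simp only [traceWord_apply]
  have hq := h.two_lt
  refine Nat.eq_of_mul_eq_mul_right (show 0 < q ^ 2 by positivity) ?_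
  simp only [Fin.forall_fin_two, Matrix.cons_val_zero, Matrix.cons_val_one] at h1
  rw [h1]
  ring

theorem sum_zeroCount [Fintype L] (h : IsOvoidRoot F q ε) :
    ∑ a : L, zeroCount (traceWord F (q ^ 2 + 1) ε a) = (q ^ 2 + 1) * q ^ 3 := by
  simp only [zeroCount, Finset.card_filter]
  rw [Finset.sum_comm]
  simp only [← Finset.card_filter, h.card_traceWord_eq_zero]
  simp

/-- Squaring counts ordered pairs of zeros: a diagonal pair occurs for `q ^ 3` values of `a`, and
each of the `q ^ 2` other choices of `j` for `q ^ 2` values. -/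
theorem sum_zeroCount_sq [Fintype L] (h : IsOvoidRoot F q ε) :
    ∑ a : L, zeroCount (traceWord F (q ^ 2 + 1) ε a) ^ 2 =
      (q ^ 2 + 1) * (q ^ 3 + q ^ 2 * q ^ 2) := by
  simp only [zeroCount, Finset.card_filter, sq (∑ i : Fin (q ^ 2 + 1), _), Finset.sum_mul_sum]
  rw [Finset.sum_comm]
  have hi : ∀ i : Fin (q ^ 2 + 1),
      (∑ a : L, ∑ j : Fin (q ^ 2 + 1), (if traceWord F (q ^ 2 + 1) ε a i = 0 then 1 else 0) *
        (if traceWord F (q ^ 2 + 1) ε a j = 0 then 1 else 0)) = q ^ 3 + q ^ 2 * q ^ 2 := by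
    intro i
    rw [Finset.sum_comm, ← Finset.add_sum_erase _ _ (Finset.mem_univ i)]
    congr 1
    · rw [← h.card_traceWord_eq_zero i, Finset.card_filter]
      exact Finset.sum_congr rfl fun a _ => by split_ifs <;> rfl
    · have hj : ∀ j ∈ Finset.univ.erase i,
          (∑ a : L, (if traceWord F (q ^ 2 + 1) ε a i = 0 then 1 else 0) *
            (if traceWord F (q ^ 2 + 1) ε a j = 0 then 1 else 0)) = q ^ 2 := by
        intro j hj
        refine Eq.trans ?_ (h.card_traceWord_eq_zero_and (Finset.ne_of_mem_erase hj).symm)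
        rw [Finset.card_filter]
        exact Finset.sum_congr rfl fun a _ => by
          rw [ite_and]
          split_ifs <;> rfl
      rw [Finset.sum_congr rfl hj, Finset.sum_const, Finset.card_erase_of_mem (Finset.mem_univ _),
        Finset.card_univ, Fintype.card_fin, smul_eq_mul, Nat.add_sub_cancel]
  rw [Finset.sum_congr rfl fun i _ => hi i]
  simp

end IsOvoidRoot

/-! ### The cone over the ovoid and the two nonzero weights. -/

namespace IsOvoidRoot

variable {F L : Type*} [Field F] [Field L] [Algebra F L] {q : ℕ} {ε : L}

/-- The nonzero `F`-multiples of the powers of `ε`. -/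
noncomputable def _root_.ovoidCone (F : Type*) {L : Type*} [Field F] [Field L] [Algebra F L]
    [Fintype F] (n : ℕ) (ε : L) : Finset L :=
  open scoped Classical in
  ((Finset.univ.erase (0 : F)) ×ˢ (Finset.univ : Finset (Fin n))).image
    fun p => p.1 • ε ^ (p.2 : ℕ)

theorem _root_.mem_ovoidCone [Fintype F] {n : ℕ} {a : L} :
    a ∈ ovoidCone F n ε ↔ ∃ f : F, f ≠ 0 ∧ ∃ i : Fin n, f • ε ^ (i : ℕ) = a := by
  classical
  simp [ovoidCone]

theorem card_ovoidCone [Fintype F] (h : IsOvoidRoot F q ε) :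
    (ovoidCone F (q ^ 2 + 1) ε).card = (q - 1) * (q ^ 2 + 1) := by
  classical
  rw [ovoidCone, Finset.card_image_of_injOn, Finset.card_product, Finset.card_univ,
    Fintype.card_fin]
  · congr 1
    rw [Finset.card_erase_of_mem (Finset.mem_univ _), Finset.card_univ,
      ← Nat.card_eq_fintype_card, h.card_base]
  · rintro ⟨f, i⟩ hf ⟨g, j⟩ hg hfg
    have hg0 : g ≠ 0 := by simpa using hg
    have hij : i = j := by
      refine Fin.ext (h.eq_of_pow_eq_smul_pow i.2 j.2 (f := g⁻¹ * f) ?_)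
      rw [mul_smul, show f • ε ^ (i : ℕ) = g • ε ^ (j : ℕ) from hfg, smul_smul,
        inv_mul_cancel₀ hg0, one_smul]
    subst hij
    have : f = g := smul_left_injective F (pow_ne_zero (i : ℕ) h.ne_zero) hfg
    rw [this]

theorem zero_notMem_ovoidCone [Fintype F] (h : IsOvoidRoot F q ε) :
    (0 : L) ∉ ovoidCone F (q ^ 2 + 1) ε := by
  rw [mem_ovoidCone]
  rintro ⟨f, hf, i, e⟩
  exact smul_ne_zero hf (pow_ne_zero (i : ℕ) h.ne_zero) e

theorem exists_notMem_ovoidCone [Fintype F] (h : IsOvoidRoot F q ε) :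
    ∃ a : L, a ≠ 0 ∧ a ∉ ovoidCone F (q ^ 2 + 1) ε := by
  classical
  have := h.finite_top
  have := Fintype.ofFinite L
  have hlt : (insert 0 (ovoidCone F (q ^ 2 + 1) ε)).card < (Finset.univ : Finset L).card := by
    rw [Finset.card_insert_of_notMem h.zero_notMem_ovoidCone, h.card_ovoidCone, Finset.card_univ,
      ← Nat.card_eq_fintype_card, h.card_top]
    obtain ⟨m, rfl⟩ : ∃ m, q = m + 1 := ⟨q - 1, by have := h.two_lt; omega⟩
    have : m * ((m + 1) ^ 2 + 1) + 1 < (m + 1) ^ 4 := by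
      have hm : 0 < m := by have := h.two_lt; omega
      nlinarith [pow_pos hm 3, pow_pos hm 4, pow_pos hm 2]
    simpa using this
  obtain ⟨a, -, ha⟩ := Finset.exists_mem_notMem_of_card_lt_card hlt
  rw [Finset.mem_insert, not_or] at ha
  exact ⟨a, ha⟩

variable [DecidableEq F]

/-- By `trace_pow_eq_zero_iff`, the zeros form a single residue class modulo `q ^ 2 + 1`: the
hyperplane is tangent to the ovoid. -/
theorem zeroCount_traceWord_smul_pow (h : IsOvoidRoot F q ε) {f : F} (hf : f ≠ 0) (k : ℕ) :
    zeroCount (traceWord F (q ^ 2 + 1) ε (f • ε ^ k)) = 1 := by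
  have hiff : ∀ i : Fin (q ^ 2 + 1), traceWord F (q ^ 2 + 1) ε (f • ε ^ k) i = 0 ↔
      q ^ 2 + 1 ∣ (k + (q ^ 2 + 1) / 2) + i := by
    intro i
    rw [traceWord_apply, smul_mul_assoc, map_smul, smul_eq_mul, mul_eq_zero, or_iff_right hf,
      ← pow_add, h.trace_pow_eq_zero_iff, add_right_comm]
  set m := k + (q ^ 2 + 1) / 2
  have hn : 0 < q ^ 2 + 1 := by positivity
  generalize q ^ 2 + 1 = n at hiff hn
  rw [zeroCount, Finset.card_eq_one]
  -- The representative of `-m`; the outer `%` handles the case `n ∣ m`.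
  refine ⟨⟨(n - m % n) % n, Nat.mod_lt _ hn⟩, ?_⟩
  ext i
  rw [Finset.mem_filter_univ, hiff, Finset.mem_singleton, Fin.ext_iff]
  have hm := Nat.mod_lt m hn
  have hi := i.2
  have h1 : n ∣ m + i ↔ n ∣ m % n + i := by
    rw [Nat.dvd_iff_mod_eq_zero, Nat.dvd_iff_mod_eq_zero, Nat.mod_add_mod]
  rw [h1]
  change _ ↔ (i : ℕ) = (n - m % n) % n
  rcases Nat.eq_zero_or_pos (m % n) with h0 | h0
  · rw [h0, zero_add, Nat.sub_zero, Nat.mod_self]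
    exact ⟨fun hd => Nat.eq_zero_of_dvd_of_lt hd hi, fun e => e ▸ dvd_zero _⟩
  · rw [Nat.mod_eq_of_lt (by omega : n - m % n < n)]
    constructor
    · rintro ⟨c, hc⟩
      have : c = 1 := by
        have h2 : n * c < n * 2 := by omega
        have h3 : c < 2 := Nat.lt_of_mul_lt_mul_left h2
        have h4 : c ≠ 0 := by rintro rfl; omega
        omega
      subst this
      omega
    · intro e
      exact ⟨1, by omega⟩

theorem zeroCount_of_mem_ovoidCone [Fintype F] (h : IsOvoidRoot F q ε) {a : L}
    (ha : a ∈ ovoidCone F (q ^ 2 + 1) ε) : zeroCount (traceWord F (q ^ 2 + 1) ε a) = 1 := by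
  obtain ⟨f, hf, i, rfl⟩ := mem_ovoidCone.mp ha
  exact h.zeroCount_traceWord_smul_pow hf i

theorem zeroCount_traceWord_zero : zeroCount (traceWord F (q ^ 2 + 1) ε 0) = q ^ 2 + 1 := by
  simp [zeroCount]

/-- Off the cone, the sum of squared deviations from `q + 1` vanishes. -/
theorem zeroCount_of_notMem_ovoidCone [Fintype F] [Fintype L] (h : IsOvoidRoot F q ε) {a : L}
    (ha0 : a ≠ 0) (ha : a ∉ ovoidCone F (q ^ 2 + 1) ε) :
    zeroCount (traceWord F (q ^ 2 + 1) ε a) = q + 1 := by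
  classical
  set z : L → ℤ := fun a => zeroCount (traceWord F (q ^ 2 + 1) ε a) with hz
  set S := ovoidCone F (q ^ 2 + 1) ε with hS
  have hcard : (Finset.univ : Finset L).card = q ^ 4 := by
    rw [Finset.card_univ, ← Nat.card_eq_fintype_card, h.card_top]
  have hq := h.two_lt
  have hs1 : ∑ a : L, z a = ((q : ℤ) ^ 2 + 1) * q ^ 3 := by
    have := congrArg (Nat.cast : ℕ → ℤ) h.sum_zeroCount
    push_cast at this
    exact this
  have hs2 : ∑ a : L, z a ^ 2 = ((q : ℤ) ^ 2 + 1) * (q ^ 3 + q ^ 2 * q ^ 2) := by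
    have := congrArg (Nat.cast : ℕ → ℤ) h.sum_zeroCount_sq
    push_cast at this
    exact this
  have htot : ∑ a : L, (z a - (q + 1)) ^ 2 = (q : ℤ) ^ 5 - q ^ 3 := by
    have e : ∀ a : L, (z a - (q + 1)) ^ 2 = z a ^ 2 - 2 * (q + 1) * z a + ((q : ℤ) + 1) ^ 2 :=
      fun a => by ring
    simp only [e]
    rw [Finset.sum_add_distrib, Finset.sum_sub_distrib, ← Finset.mul_sum, hs1, hs2,
      Finset.sum_const, hcard, nsmul_eq_mul]
    push_cast
    ring
  have hsumS : ∑ a ∈ S, (z a - (q + 1)) ^ 2 = ((q : ℤ) - 1) * (q ^ 2 + 1) * q ^ 2 := by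
    have e : ∀ a ∈ S, (z a - (q + 1)) ^ 2 = (q : ℤ) ^ 2 := by
      intro a ha
      have : z a = 1 := by
        simp only [hz]
        exact_mod_cast h.zeroCount_of_mem_ovoidCone ha
      rw [this]
      ring
    rw [Finset.sum_congr rfl e, Finset.sum_const, h.card_ovoidCone, nsmul_eq_mul]
    push_cast [Nat.cast_sub (show 1 ≤ q by omega)]
    ring
  have hz0 : z 0 = (q : ℤ) ^ 2 + 1 := by
    simp only [hz, zeroCount_traceWord_zero]
    push_cast
    ring
  -- Zero and the cone already exhaust the total `htot`, leaving nothing for the remaining `a`.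
  have hsum0 : ∑ a ∈ insert 0 S, (z a - (q + 1)) ^ 2 = (q : ℤ) ^ 5 - q ^ 3 := by
    rw [Finset.sum_insert h.zero_notMem_ovoidCone, hsumS, hz0]
    ring
  have hrest : ∑ a ∈ (insert 0 S)ᶜ, (z a - (q + 1)) ^ 2 = 0 := by
    have := Finset.sum_add_sum_compl (insert 0 S) fun a => (z a - (q + 1)) ^ 2
    rw [hsum0, htot] at this
    linarith
  rw [Finset.sum_eq_zero_iff_of_nonneg fun a _ => sq_nonneg _] at hrest
  have := hrest a (by simp [ha0, ha])
  have h1 : z a = q + 1 := by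
    have := pow_eq_zero_iff (two_ne_zero' ℕ) |>.mp this
    linarith
  simp only [hz] at h1
  exact_mod_cast h1

theorem hammingNorm_of_mem_ovoidCone [Fintype F] (h : IsOvoidRoot F q ε) {a : L}
    (ha : a ∈ ovoidCone F (q ^ 2 + 1) ε) :
    hammingNorm (traceWord F (q ^ 2 + 1) ε a) = q ^ 2 := by
  have h1 := hammingNorm_add_zeroCount (traceWord F (q ^ 2 + 1) ε a)
  rw [h.zeroCount_of_mem_ovoidCone ha] at h1
  omega

theorem hammingNorm_of_notMem_ovoidCone [Fintype F] [Fintype L] (h : IsOvoidRoot F q ε) {a : L}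
    (ha0 : a ≠ 0) (ha : a ∉ ovoidCone F (q ^ 2 + 1) ε) :
    hammingNorm (traceWord F (q ^ 2 + 1) ε a) = q ^ 2 - q := by
  have h1 := hammingNorm_add_zeroCount (traceWord F (q ^ 2 + 1) ε a)
  rw [h.zeroCount_of_notMem_ovoidCone ha0 ha] at h1
  omega

theorem traceWord_injective (h : IsOvoidRoot F q ε) :
    Function.Injective (traceWord F (q ^ 2 + 1) ε) := by
  have := h.finite_base
  have := Fintype.ofFinite F
  have := h.finite_top
  have := Fintype.ofFinite L
  rw [← LinearMap.ker_eq_bot, LinearMap.ker_eq_bot']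
  intro a ha
  by_contra ha0
  have h0 : zeroCount (traceWord F (q ^ 2 + 1) ε a) = q ^ 2 + 1 := by
    rw [ha]; simp [zeroCount]
  have hq := h.two_lt
  by_cases hS : a ∈ ovoidCone F (q ^ 2 + 1) ε
  · rw [h.zeroCount_of_mem_ovoidCone hS] at h0
    nlinarith
  · rw [h.zeroCount_of_notMem_ovoidCone ha0 hS] at h0
    nlinarith

end IsOvoidRoot

/-! ### Generalities on parameters, duals and weight enumerators. -/

section LinearCodes

variable {F : Type*} [Field F] {n : ℕ}

theorem hasParameters_of_hammingNorm [DecidableEq F] {C : Submodule F (Fin n → F)} {k d : ℕ}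
    (hk : Module.finrank F C = k) (hd : ∀ c ∈ C, c ≠ 0 → d ≤ hammingNorm c)
    (hex : ∃ c ∈ C, c ≠ 0 ∧ hammingNorm c = d) : HasParameters C k d := by
  refine ⟨hk, ?_, ?_⟩
  · obtain ⟨c, hc, hc0, hcd⟩ := hex
    exact ⟨c, hc, 0, C.zero_mem, hc0, by rw [hammingDist_zero_right, hcd]⟩
  · rintro e ⟨x, hx, y, hy, hxy, rfl⟩
    rw [hammingDist_eq_hammingNorm]
    exact hd _ (C.add_mem (C.neg_mem hx) hy) (by rwa [Ne, neg_add_eq_zero])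

theorem finrank_add_finrank_dualCode (C : Submodule F (Fin n → F)) :
    Module.finrank F C + Module.finrank F (dualCode C) = n := by
  have h : dualCode C = C.dualAnnihilator.comap (dotProductEquiv F (Fin n)).toLinearMap := by
    ext x
    rw [Submodule.mem_comap, Submodule.mem_dualAnnihilator]
    rfl
  have h1 : Module.finrank F (dualCode C) = Module.finrank F C.dualAnnihilator := by
    rw [h, Submodule.comap_equiv_eq_map_symm, LinearEquiv.finrank_map_eq]
  rw [h1, Subspace.finrank_add_finrank_dualAnnihilator_eq, Module.finrank_fin_fun]

theorem weightEnumerator_range [DecidableEq F] {V : Type*} [AddCommGroup V] [Module F V]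
    [Fintype V] {T : V →ₗ[F] (Fin n → F)} (hT : Function.Injective T) :
    weightEnumerator (LinearMap.range T) = ∑ a : V, X ^ hammingNorm (T a) := by
  have hcount : ∀ i, weightCount (LinearMap.range T) i =
      Finset.card {a : V | hammingNorm (T a) = i} := by
    intro i
    rw [weightCount, ← Set.ncard_coe_finset, ← Set.ncard_image_of_injective _ hT]
    congr 1
    ext c
    simp only [Set.mem_ofPred_eq, LinearMap.mem_range, Set.mem_image, Finset.coe_filter,
      Finset.mem_univ, true_and]
    constructor
    · rintro ⟨⟨a, rfl⟩, ha⟩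
      exact ⟨a, ha, rfl⟩
    · rintro ⟨a, ha, rfl⟩
      exact ⟨⟨a, rfl⟩, ha⟩
  rw [weightEnumerator, ← Finset.sum_fiberwise_of_maps_to (s := Finset.univ)
    (t := Finset.range (n + 1)) (g := fun a : V => hammingNorm (T a))]
  · refine Finset.sum_congr rfl fun i _ => ?_
    rw [hcount, Finset.sum_congr rfl
      (g := fun _ => X ^ i) fun a ha => by rw [(Finset.mem_filter_univ a).mp ha]]
    rw [Finset.sum_const, nsmul_eq_mul]
    simp
  · intro a _
    rw [Finset.mem_range, Nat.lt_succ_iff]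
    simpa using hammingNorm_le_card_fintype (x := T a)

end LinearCodes

/-! ### The trace code and its dual. -/

namespace IsOvoidRoot

variable {F L : Type*} [Field F] [Field L] [Algebra F L] {q : ℕ} {ε : L}

theorem finrank_range_traceWord (h : IsOvoidRoot F q ε) :
    Module.finrank F (LinearMap.range (traceWord F (q ^ 2 + 1) ε)) = 4 := by
  classical
  rw [LinearMap.finrank_range_of_inj h.traceWord_injective, h.finrank_top]

theorem isNegacyclic_range_traceWord (h : IsOvoidRoot F q ε) :
    IsNegacyclic (LinearMap.range (traceWord F (q ^ 2 + 1) ε)) := by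
  rintro _ ⟨a, rfl⟩
  -- Shifting lowers the exponent of `ε` by one; the wrap-around sign is `ε ^ (q ^ 2 + 1) = -1`.
  refine ⟨a * ε⁻¹, ?_⟩
  have h0 := h.ne_zero
  ext i
  rw [traceWord_apply, constacyclicShift]
  split_ifs with hi
  · rw [traceWord_apply, hi, neg_one_mul, ← map_neg]
    congr 1
    have h1 : ε ^ (q ^ 2) * ε = -1 := by rw [← pow_succ, h.pow_half]
    change _ = -(a * ε ^ (q ^ 2 + 1 - 1))
    rw [Nat.add_sub_cancel]
    field_simp
    linear_combination a * h1
  · rw [traceWord_apply]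
    congr 1
    change _ = a * ε ^ ((i : ℕ) - 1)
    obtain ⟨j, hj⟩ : ∃ j, (i : ℕ) = j + 1 := ⟨(i : ℕ) - 1, by omega⟩
    rw [hj, Nat.add_sub_cancel, pow_succ]
    field_simp

theorem mem_dualCode_range_traceWord (h : IsOvoidRoot F q ε) (x : Fin (q ^ 2 + 1) → F) :
    x ∈ dualCode (LinearMap.range (traceWord F (q ^ 2 + 1) ε)) ↔
      ∑ i, x i • ε ^ (i : ℕ) = 0 := by
  have := h.finite_top
  have hdot : ∀ a, x ⬝ᵥ traceWord F (q ^ 2 + 1) ε a =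
      Algebra.traceForm F L (∑ i, x i • ε ^ (i : ℕ)) a := by
    intro a
    rw [Algebra.traceForm_apply, Finset.sum_mul, map_sum]
    refine Finset.sum_congr rfl fun i _ => ?_
    rw [smul_mul_assoc, map_smul, smul_eq_mul, mul_comm (ε ^ (i : ℕ)) a, traceWord_apply]
  constructor
  · intro hx
    refine (traceForm_nondegenerate F L).1 _ fun a => ?_
    rw [← hdot]
    exact hx _ ⟨a, rfl⟩
  · rintro hx _ ⟨a, rfl⟩
    rw [hdot, hx, map_zero, LinearMap.zero_apply]

variable [DecidableEq F]

theorem hasParameters_range_traceWord (h : IsOvoidRoot F q ε) :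
    HasParameters (LinearMap.range (traceWord F (q ^ 2 + 1) ε)) 4 (q ^ 2 - q) := by
  have := h.finite_base
  have := Fintype.ofFinite F
  have := h.finite_top
  have := Fintype.ofFinite L
  refine hasParameters_of_hammingNorm h.finrank_range_traceWord ?_ ?_
  · rintro _ ⟨a, rfl⟩ ha
    have ha0 : a ≠ 0 := by
      rintro rfl
      exact ha (map_zero _)
    by_cases hS : a ∈ ovoidCone F (q ^ 2 + 1) ε
    · rw [h.hammingNorm_of_mem_ovoidCone hS]
      exact Nat.sub_le _ _
    · rw [h.hammingNorm_of_notMem_ovoidCone ha0 hS]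
  · obtain ⟨a, ha0, ha⟩ := h.exists_notMem_ovoidCone
    exact ⟨_, ⟨a, rfl⟩, (map_ne_zero_iff _ h.traceWord_injective).mpr ha0,
      h.hammingNorm_of_notMem_ovoidCone ha0 ha⟩

theorem weightEnumerator_range_traceWord (h : IsOvoidRoot F q ε) :
    weightEnumerator (LinearMap.range (traceWord F (q ^ 2 + 1) ε)) =
      1 + C (((q : ℤ) ^ 2 - q) * ((q : ℤ) ^ 2 + 1)) * X ^ (q ^ 2 - q)
        + C (((q : ℤ) - 1) * ((q : ℤ) ^ 2 + 1)) * X ^ (q ^ 2) := by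
  classical
  have := h.finite_base
  have := Fintype.ofFinite F
  have := h.finite_top
  have := Fintype.ofFinite L
  have hq := h.two_lt
  rw [weightEnumerator_range h.traceWord_injective,
    ← Finset.sum_add_sum_compl (insert 0 (ovoidCone F (q ^ 2 + 1) ε)),
    Finset.sum_insert h.zero_notMem_ovoidCone,
    Finset.sum_congr rfl (g := fun _ => X ^ (q ^ 2))
      fun a ha => by rw [h.hammingNorm_of_mem_ovoidCone ha],
    Finset.sum_congr (s₁ := (insert 0 (ovoidCone F (q ^ 2 + 1) ε))ᶜ) rfl
      (g := fun _ => X ^ (q ^ 2 - q)) fun a ha => by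
        rw [Finset.mem_compl, Finset.mem_insert, not_or] at ha
        rw [h.hammingNorm_of_notMem_ovoidCone ha.1 ha.2],
    Finset.sum_const, Finset.sum_const, Finset.card_compl,
    Finset.card_insert_of_notMem h.zero_notMem_ovoidCone, h.card_ovoidCone,
    ← Nat.card_eq_fintype_card, h.card_top, map_zero, hammingNorm_zero, pow_zero]
  have h1 : q ^ 4 - ((q - 1) * (q ^ 2 + 1) + 1) = (q ^ 2 - q) * (q ^ 2 + 1) := by
    obtain ⟨m, rfl⟩ : ∃ m, q = m + 1 := ⟨q - 1, by omega⟩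
    rw [show (m + 1) ^ 2 - (m + 1) = m * (m + 1) by
      rw [Nat.sub_eq_iff_eq_add (by nlinarith)]; ring, Nat.add_sub_cancel]
    have : (m + 1) ^ 4 = m * (m + 1) * ((m + 1) ^ 2 + 1) + (m * ((m + 1) ^ 2 + 1) + 1) := by ring
    omega
  rw [h1, nsmul_eq_mul, nsmul_eq_mul]
  have h2 : q ≤ q ^ 2 := by nlinarith
  push_cast [Nat.cast_sub h2, Nat.cast_sub (show 1 ≤ q by omega)]
  simp only [map_mul, map_sub, map_add, map_pow, map_one, map_natCast]
  ring

/-- A non-tangent plane contains `q + 1 ≥ 4` points of the ovoid. Four of them are dependent, since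
four independent points would force `a = 0`. -/
theorem exists_mem_dualCode_hammingNorm_le_four (h : IsOvoidRoot F q ε) :
    ∃ c ∈ dualCode (LinearMap.range (traceWord F (q ^ 2 + 1) ε)), c ≠ 0 ∧ hammingNorm c ≤ 4 := by
  have := h.finite_base
  have := Fintype.ofFinite F
  have := h.finite_top
  have := Fintype.ofFinite L
  obtain ⟨a, ha0, ha⟩ := h.exists_notMem_ovoidCone
  have hz := h.zeroCount_of_notMem_ovoidCone ha0 ha
  obtain ⟨t, ht, ht4⟩ := Finset.exists_subset_card_eq
    (show 4 ≤ Finset.card {i | traceWord F (q ^ 2 + 1) ε a i = 0} by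
      have := h.two_lt
      rw [zeroCount] at hz
      omega)
  have hdep : ¬ LinearIndepOn F (fun i : Fin (q ^ 2 + 1) => ε ^ (i : ℕ)) (t : Set _) := by
    intro hli
    have hcard := natCard_trace_mul_eq_zero (LinearIndepOn.linearIndependent hli)
    have h4 : Fintype.card (t : Set (Fin (q ^ 2 + 1))) = 4 := by simpa using ht4
    rw [h4, h.card_base, h.card_top] at hcard
    have hone : Nat.card {b : L // ∀ i : (t : Set (Fin (q ^ 2 + 1))),
        Algebra.trace F L (b * ε ^ ((i : Fin (q ^ 2 + 1)) : ℕ)) = 0} = 1 := by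
      have := pow_pos (show 0 < q by have := h.two_lt; omega) 4
      exact Nat.eq_of_mul_eq_mul_right this (by rw [hcard, one_mul])
    have hsub := (Nat.card_eq_one_iff_unique.mp hone).1
    have := hsub.elim ⟨a, fun i => (Finset.mem_filter.mp (ht i.2)).2⟩
      ⟨0, fun i => by rw [zero_mul, map_zero]⟩
    exact ha0 (congrArg Subtype.val this)
  obtain ⟨f, hf, i, hi, hfi⟩ := not_linearIndepOn_finset_iff.mp hdep
  refine ⟨fun i => if i ∈ t then f i else 0, ?_, ?_, ?_⟩
  · rw [h.mem_dualCode_range_traceWord, ← hf]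
    simp [ite_smul]
  · intro e
    have := congrFun e i
    simp only [if_pos hi, Pi.zero_apply] at this
    exact hfi this
  · rw [← ht4, hammingNorm]
    refine Finset.card_le_card fun j hj => ?_
    rw [Finset.mem_filter_univ] at hj
    by_contra hjt
    exact hj (if_neg hjt)

theorem hasParameters_dualCode_range_traceWord (h : IsOvoidRoot F q ε) :
    HasParameters (dualCode (LinearMap.range (traceWord F (q ^ 2 + 1) ε))) (q ^ 2 - 3) 4 := by
  have hmin : ∀ c ∈ dualCode (LinearMap.range (traceWord F (q ^ 2 + 1) ε)), c ≠ 0 →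
      4 ≤ hammingNorm c := by
    intro c hc hc0
    by_contra hlt
    exact hc0 (h.eq_zero_of_sum_smul_pow_eq_zero ((h.mem_dualCode_range_traceWord c).mp hc)
      (by omega))
  refine hasParameters_of_hammingNorm ?_ hmin ?_
  · have h1 := finrank_add_finrank_dualCode (LinearMap.range (traceWord F (q ^ 2 + 1) ε))
    rw [h.finrank_range_traceWord] at h1
    omega
  · obtain ⟨c, hc, hc0, hc4⟩ := h.exists_mem_dualCode_hammingNorm_le_four
    exact ⟨c, hc, hc0, le_antisymm hc4 (hmin c hc hc0)⟩

end IsOvoidRoot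

/-! ### Constacyclic codes described by roots. -/

section Constacyclic

variable {K : Type*} [Field K] {n : ℕ}

/-- The polynomial `c₀ + c₁ x + ⋯ + cₙ₋₁ xⁿ⁻¹`. -/
noncomputable def wordPolynomial (c : Fin n → K) : K[X] := ∑ i, C (c i) * X ^ (i : ℕ)

theorem codePolynomial_eq_mk (lam : K) (c : Fin n → K) :
    codePolynomial n lam c = AdjoinRoot.mk (X ^ n - C lam) (wordPolynomial c) := by
  rw [codePolynomial, Fintype.linearCombination_apply, wordPolynomial, map_sum]
  refine Finset.sum_congr rfl fun i _ => ?_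
  rw [map_mul, map_pow, AdjoinRoot.mk_X, AdjoinRoot.mk_C, Algebra.smul_def]
  rfl

theorem mem_constacyclicCodeOfCheck_iff {lam : K} {h : K[X]} (hm : h.Monic)
    (hdvd : h ∣ X ^ n - C lam) (c : Fin n → K) :
    c ∈ constacyclicCodeOfCheck n lam h ↔ X ^ n - C lam ∣ wordPolynomial c * h := by
  set f := X ^ n - C lam with hf
  have hgh : f = (f /ₘ h) * h := by
    have := modByMonic_add_div f h
    rw [(modByMonic_eq_zero_iff_dvd hm).mpr hdvd, zero_add] at this
    rw [mul_comm, this]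
  have hmem : c ∈ constacyclicCodeOfCheck n lam h ↔
      AdjoinRoot.mk f (wordPolynomial c) ∈ Ideal.span {AdjoinRoot.mk f (f /ₘ h)} := by
    rw [constacyclicCodeOfCheck, constacyclicCode, Submodule.mem_comap, codePolynomial_eq_mk]
    rfl
  rw [hmem, Ideal.mem_span_singleton]
  set g := f /ₘ h
  have hg : AdjoinRoot.mk f g ∣ AdjoinRoot.mk f (wordPolynomial c) ↔ g ∣ wordPolynomial c := by
    refine ⟨?_, fun hd => map_dvd _ hd⟩
    rintro ⟨r, hr⟩
    obtain ⟨r, rfl⟩ := AdjoinRoot.mk_surjective r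
    rw [← map_mul, AdjoinRoot.mk_eq_mk] at hr
    have h1 : g ∣ wordPolynomial c - g * r := (Dvd.intro _ hgh.symm).trans hr
    simpa using dvd_add h1 (dvd_mul_right g r)
  rw [hg, hgh, mul_dvd_mul_iff_right hm.ne_zero]

end Constacyclic

theorem X_pow_sub_C_dvd_iff_eval_eq_zero {L : Type*} [Field L] {n : ℕ} {ζ α b : L}
    (hn : 0 < n) (hζ : IsPrimitiveRoot ζ n) (hα0 : α ≠ 0) (hα : α ^ n = b) (p : L[X]) :
    X ^ n - C b ∣ p ↔ ∀ θ, θ ^ n = b → p.eval θ = 0 := by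
  constructor
  · rintro ⟨r, rfl⟩ θ hθ
    simp [hθ]
  · intro h
    rw [X_pow_sub_C_eq_prod hζ hn hα]
    refine Finset.prod_dvd_of_coprime ?_ fun x hx => ?_
    · intro x hx y hy hxy
      refine isCoprime_X_sub_C_of_isUnit_sub (sub_ne_zero.mpr fun e => hxy ?_).isUnit
      exact hζ.pow_inj (Finset.mem_range.mp hx) (Finset.mem_range.mp hy) (mul_right_cancel₀ hα0 e)
    · rw [dvd_iff_isRoot]
      refine h _ ?_
      rw [mul_pow, hα, ← pow_mul, mul_comm x, pow_mul, hζ.pow_eq_one, one_pow, one_mul]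

/-- The quadratic `(X - x)(X - τ x)` has coefficients in `K`, so the minimal polynomial divides it.
-/
theorem aeval_minpoly_eq_zero_iff_of_pow_card_sq {K L : Type*} [Field K] [Field L] [Algebra K L]
    [Finite K] (hL : ∀ x : L, (x ^ Nat.card K) ^ Nat.card K = x) (x θ : L) :
    aeval θ (minpoly K x) = 0 ↔ θ = x ∨ θ = x ^ Nat.card K := by
  obtain ⟨τ, hτ⟩ := exists_frobenius K L
  constructor
  · intro hθ
    obtain ⟨s, hs⟩ : ∃ s : K, algebraMap K L s = x + τ x := by
      refine exists_algebraMap_eq_of_pow_natCard_eq ?_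
      rw [← hτ, map_add, hτ (τ x), hτ x, hL, add_comm]
    obtain ⟨m, hm⟩ : ∃ m : K, algebraMap K L m = x * τ x := by
      refine exists_algebraMap_eq_of_pow_natCard_eq ?_
      rw [← hτ, map_mul, hτ (τ x), hτ x, hL, mul_comm]
    have hp : ∀ y, aeval y (X ^ 2 - C s * X + C m : K[X]) = (y - x) * (y - τ x) := by
      intro y
      simp only [map_add, map_sub, map_mul, map_pow, aeval_X, aeval_C, hs, hm]
      ring
    obtain ⟨r, hr⟩ := minpoly.dvd K x (p := X ^ 2 - C s * X + C m) (by rw [hp]; ring)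
    have := hp θ
    rw [hr, map_mul, hθ, zero_mul, eq_comm, mul_eq_zero, sub_eq_zero, sub_eq_zero, hτ] at this
    exact this
  · rintro (rfl | rfl)
    · exact minpoly.aeval _ _
    · rw [← hτ, aeval_algHom_apply, minpoly.aeval, map_zero]

/-! ### The Fourier transform of a trace word. -/

namespace IsOvoidRoot

variable {F L : Type*} [Field F] [Field L] [Algebra F L] {q : ℕ} {δ : L}

theorem frobenius_iterate_ne (h : IsOvoidRoot F q δ) {σ : L →ₐ[F] L} (hσ : ∀ x, σ x = x ^ q) :
    σ δ ≠ δ ∧ σ (σ δ) ≠ δ ∧ σ (σ (σ δ)) ≠ δ := by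
  have hq := h.two_lt
  have h1 : σ δ ≠ δ := by
    have := (h.pow_pow_eq_self_iff 1).not.mpr
      (Nat.not_dvd_of_pos_of_lt one_pos (by nlinarith))
    rwa [pow_one, ← hσ] at this
  refine ⟨h1, fun e => ?_, fun e => h1 ?_⟩
  · rw [hσ, hσ, ← pow_mul, ← sq] at e
    have h2 : δ ^ 2 = -1 := by rw [← h.pow_half, pow_succ (n := q ^ 2), e, sq]
    refine h.primitive.pow_ne_one_of_pos_of_lt (l := 4) (by norm_num) (by nlinarith) ?_
    rw [show δ ^ 4 = (δ ^ 2) ^ 2 by ring, h2]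
    ring
  · have h4 : σ (σ (σ (σ δ))) = δ := by
      rw [hσ, hσ, hσ, hσ, ← pow_mul, ← pow_mul, ← pow_mul]
      convert h.pow_natCard δ using 2
      ring
    rwa [e] at h4

/-- This makes Fourier inversion free of a normalizing factor. -/
theorem cast_length (h : IsOvoidRoot F q δ) : ((q ^ 2 + 1 : ℕ) : L) = 1 := by
  have := h.finite_base
  have := Fintype.ofFinite F
  have h0 : ((q : ℕ) : F) = 0 := by
    rw [← h.card_base, Nat.card_eq_fintype_card, FiniteField.cast_card_eq_zero]
  have h1 : (q : L) = 0 := by rw [← map_natCast (algebraMap F L), h0, map_zero]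
  push_cast
  rw [h1]
  ring

theorem sum_pow_eq_ite [DecidableEq L] (h : IsOvoidRoot F q δ) {x : L} (hx : x ^ (q ^ 2 + 1) = 1) :
    ∑ i : Fin (q ^ 2 + 1), x ^ (i : ℕ) = if x = 1 then 1 else 0 := by
  rw [Fin.sum_univ_eq_sum_range fun i => x ^ i]
  split_ifs with h1
  · simp only [h1, one_pow, Finset.sum_const, Finset.card_range, nsmul_eq_mul, mul_one]
    exact h.cast_length
  · rw [geom_sum_eq h1, hx, sub_self, zero_div]

/-- Expand the trace into four conjugates. Each gives a geometric sum in `θ / τ δ`, which vanishes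
unless `θ = τ δ`. -/
theorem sum_traceWord_mul_pow [DecidableEq L] (h : IsOvoidRoot F q δ) {σ : L →ₐ[F] L}
    (hN : ∀ x, algebraMap F L (Algebra.trace F L x) = x + σ x + σ (σ x) + σ (σ (σ x)))
    (a : L) {θ : L} (hθ : θ ^ (q ^ 2 + 1) = -1) :
    ∑ i, algebraMap F L (traceWord F (q ^ 2 + 1) δ⁻¹ a i) * θ ^ (i : ℕ) =
      (if θ = δ then a else 0) + (if θ = σ δ then σ a else 0) +
      (if θ = σ (σ δ) then σ (σ a) else 0) + (if θ = σ (σ (σ δ)) then σ (σ (σ a)) else 0) := by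
  have key : ∀ τ : L →ₐ[F] L, ∑ i : Fin (q ^ 2 + 1), τ (a * δ⁻¹ ^ (i : ℕ)) * θ ^ (i : ℕ) =
      if θ = τ δ then τ a else 0 := by
    intro τ
    have h0 : τ δ ≠ 0 := (map_ne_zero_iff _ τ.injective).mpr h.ne_zero
    have h1 : (θ / τ δ) ^ (q ^ 2 + 1) = 1 := by
      rw [div_pow, hθ, ← map_pow, h.pow_half, map_neg, map_one, div_self]
      exact neg_ne_zero.mpr one_ne_zero
    have e : ∀ i : Fin (q ^ 2 + 1), τ (a * δ⁻¹ ^ (i : ℕ)) * θ ^ (i : ℕ) =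
        τ a * (θ / τ δ) ^ (i : ℕ) := by
      intro i
      rw [map_mul, map_pow, map_inv₀, div_pow, inv_pow]
      ring
    simp only [e]
    rw [← Finset.mul_sum, h.sum_pow_eq_ite h1]
    simp only [div_eq_one_iff_eq h0, mul_ite, mul_one, mul_zero]
  have h0 : ∑ i : Fin (q ^ 2 + 1), (a * δ⁻¹ ^ (i : ℕ)) * θ ^ (i : ℕ) =
      if θ = δ then a else 0 := key (AlgHom.id F L)
  have h2 : ∑ i : Fin (q ^ 2 + 1), σ (σ (a * δ⁻¹ ^ (i : ℕ))) * θ ^ (i : ℕ) =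
      if θ = σ (σ δ) then σ (σ a) else 0 := key (σ.comp σ)
  have h3 : ∑ i : Fin (q ^ 2 + 1), σ (σ (σ (a * δ⁻¹ ^ (i : ℕ)))) * θ ^ (i : ℕ) =
      if θ = σ (σ (σ δ)) then σ (σ (σ a)) else 0 := key (σ.comp (σ.comp σ))
  rw [← h0, ← key σ, ← h2, ← h3, ← Finset.sum_add_distrib,
    ← Finset.sum_add_distrib, ← Finset.sum_add_distrib]
  refine Finset.sum_congr rfl fun i _ => ?_
  rw [traceWord_apply, hN, add_mul, add_mul, add_mul]

end IsOvoidRoot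

/-! ### Identification of the subfield subcode with the trace code. -/

section SubfieldSubcode

variable {F K L : Type*} [Field F] [Field K] [Field L] [Algebra K L] [Algebra F L] {q : ℕ} {δ : L}

namespace IsOvoidRoot

/-- Here `(q² - q + 1) q² = (q² + 1)(q² - q) + q`, and `q² - q` is even, so the first summand is a
multiple of the order of `δ`. -/
theorem pow_conjugate (h : IsOvoidRoot F q δ) {σ : L →ₐ[F] L} (hσ : ∀ x, σ x = x ^ q) :
    σ (σ (δ ^ (q ^ 2 - q + 1))) = σ δ ∧ δ ^ (q ^ 2 - q + 1) = σ (σ (σ δ)) := by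
  have h1 : σ (σ (δ ^ (q ^ 2 - q + 1))) = σ δ := by
    obtain ⟨m, hm⟩ : ∃ m, q ^ 2 - q = 2 * m := by
      obtain ⟨r, rfl⟩ : ∃ r, q = r + 1 := ⟨q - 1, by have := h.two_lt; omega⟩
      rw [show (r + 1) ^ 2 - (r + 1) = r * (r + 1) by
        rw [Nat.sub_eq_iff_eq_add (by nlinarith)]; ring]
      exact (Nat.even_mul_succ_self r).two_dvd
    have h2 : (q ^ 2 - q + 1) * q * q = 2 * (q ^ 2 + 1) * m + q := by
      have h3 : q ^ 2 = 2 * m + q := by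
        have : q ≤ q ^ 2 := by nlinarith [h.two_lt]
        omega
      rw [hm]
      calc (2 * m + 1) * q * q = 2 * m * q ^ 2 + q ^ 2 := by ring
        _ = 2 * m * q ^ 2 + (2 * m + q) := by rw [← h3]
        _ = _ := by ring
    rw [hσ, hσ, hσ, ← pow_mul, ← pow_mul, ← mul_assoc, h2, pow_add, pow_mul,
      h.primitive.pow_eq_one, one_pow, one_mul]
  refine ⟨h1, ?_⟩
  rw [← h1, hσ, hσ, hσ, hσ, ← pow_mul, ← pow_mul, ← pow_mul]
  convert (h.pow_natCard (δ ^ (q ^ 2 - q + 1))).symm using 2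
  ring

theorem aeval_minpoly_eq_zero_iff (h : IsOvoidRoot F q δ) (hK : Nat.card K = q ^ 2)
    {σ : L →ₐ[F] L} (hσ : ∀ x, σ x = x ^ q) (x θ : L) :
    aeval θ (minpoly K x) = 0 ↔ θ = x ∨ θ = σ (σ x) := by
  have := h.finite_top
  have : Finite K := Finite.of_injective _ (algebraMap K L).injective
  rw [aeval_minpoly_eq_zero_iff_of_pow_card_sq, hK, hσ, hσ, ← pow_mul, sq]
  intro x
  rw [hK, ← pow_mul, ← pow_add]
  exact h.pow_natCard x

theorem aeval_minpoly_left_eq_zero_iff (h : IsOvoidRoot F q δ) (hK : Nat.card K = q ^ 2)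
    {σ : L →ₐ[F] L} (hσ : ∀ x, σ x = x ^ q) (θ : L) :
    aeval θ (minpoly K (δ ^ 1)) = 0 ↔ θ = δ ∨ θ = σ (σ δ) := by
  rw [h.aeval_minpoly_eq_zero_iff hK hσ, pow_one]

theorem aeval_minpoly_right_eq_zero_iff (h : IsOvoidRoot F q δ) (hK : Nat.card K = q ^ 2)
    {σ : L →ₐ[F] L} (hσ : ∀ x, σ x = x ^ q) (θ : L) :
    aeval θ (minpoly K (δ ^ (q ^ 2 - q + 1))) = 0 ↔ θ = σ (σ (σ δ)) ∨ θ = σ δ := by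
  rw [h.aeval_minpoly_eq_zero_iff hK hσ, (h.pow_conjugate hσ).1, (h.pow_conjugate hσ).2]

theorem aeval_checkPolynomial_eq_zero_iff (h : IsOvoidRoot F q δ) (hK : Nat.card K = q ^ 2)
    {σ : L →ₐ[F] L} (hσ : ∀ x, σ x = x ^ q) (θ : L) :
    aeval θ (minpoly K (δ ^ 1) * minpoly K (δ ^ (q ^ 2 - q + 1))) = 0 ↔
      θ = δ ∨ θ = σ δ ∨ θ = σ (σ δ) ∨ θ = σ (σ (σ δ)) := by
  rw [map_mul, mul_eq_zero, h.aeval_minpoly_left_eq_zero_iff hK hσ,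
    h.aeval_minpoly_right_eq_zero_iff hK hσ]
  tauto

theorem checkPolynomial_monic (h : IsOvoidRoot F q δ) :
    (minpoly K (δ ^ 1) * minpoly K (δ ^ (q ^ 2 - q + 1))).Monic := by
  have := h.finite_top
  exact (minpoly.monic (Algebra.IsIntegral.isIntegral _)).mul
    (minpoly.monic (Algebra.IsIntegral.isIntegral _))

theorem checkPolynomial_dvd (h : IsOvoidRoot F q δ) (hK : Nat.card K = q ^ 2) :
    minpoly K (δ ^ 1) * minpoly K (δ ^ (q ^ 2 - q + 1)) ∣ X ^ (q ^ 2 + 1) - C (-1) := by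
  have := h.finite_top
  obtain ⟨σ, hσ, -⟩ := h.exists_frobenius
  obtain ⟨h1, -, h3⟩ := h.frobenius_iterate_ne hσ
  refine IsCoprime.mul_dvd ?_ (minpoly.dvd _ _ ?_) (minpoly.dvd _ _ ?_)
  · rw [(minpoly.irreducible (Algebra.IsIntegral.isIntegral _)).coprime_iff_not_dvd]
    rintro ⟨r, hr⟩
    have h0 : aeval δ (minpoly K (δ ^ (q ^ 2 - q + 1))) = 0 := by
      rw [hr, map_mul, (h.aeval_minpoly_left_eq_zero_iff hK hσ δ).mpr (Or.inl rfl), zero_mul]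
    rcases (h.aeval_minpoly_right_eq_zero_iff hK hσ δ).mp h0 with e | e
    · exact h3 e.symm
    · exact h1 e.symm
  · simp [h.pow_half]
  · have : (δ ^ (q ^ 2 - q + 1)) ^ (q ^ 2 + 1) = -1 := by
      rw [(h.pow_conjugate hσ).2, ← map_pow, ← map_pow, ← map_pow, h.pow_half]
      simp
    simp [this]

theorem mem_negacyclicFamily_iff (h : IsOvoidRoot F q δ) (hK : Nat.card K = q ^ 2)
    {σ : L →ₐ[F] L} (hσ : ∀ x, σ x = x ^ q) (c : Fin (q ^ 2 + 1) → K) :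
    c ∈ negacyclicFamily K q δ 1 (q ^ 2 - q + 1) ↔
      ∀ θ : L, θ ^ (q ^ 2 + 1) = -1 → ¬ (θ = δ ∨ θ = σ δ ∨ θ = σ (σ δ) ∨ θ = σ (σ (σ δ))) →
        ∑ i, algebraMap K L (c i) * θ ^ (i : ℕ) = 0 := by
  have hn : 0 < q ^ 2 + 1 := by positivity
  rw [negacyclicFamily, mem_constacyclicCodeOfCheck_iff h.checkPolynomial_monic
    (h.checkPolynomial_dvd hK), ← map_dvd_map' (algebraMap K L), Polynomial.map_sub,
    Polynomial.map_pow, map_X, map_C, map_neg, map_one,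
    X_pow_sub_C_dvd_iff_eval_eq_zero hn (h.primitive.pow (by positivity) rfl) h.ne_zero h.pow_half]
  refine forall_congr' fun θ => imp_congr_right fun _ => ?_
  rw [eval_map_algebraMap, map_mul, mul_eq_zero, h.aeval_checkPolynomial_eq_zero_iff hK hσ,
    or_iff_not_imp_right]
  simp only [wordPolynomial, map_sum, map_mul, map_pow, aeval_C, aeval_X]

theorem eq_zero_of_forall_sum_mul_pow_eq_zero (h : IsOvoidRoot F q δ) {c : Fin (q ^ 2 + 1) → F}
    (hc : ∀ θ : L, θ ^ (q ^ 2 + 1) = -1 → ∑ i, algebraMap F L (c i) * θ ^ (i : ℕ) = 0) :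
    c = 0 := by
  have hn : 0 < q ^ 2 + 1 := by positivity
  have hdvd : X ^ (q ^ 2 + 1) - C (-1 : L) ∣ wordPolynomial fun i => algebraMap F L (c i) := by
    rw [X_pow_sub_C_dvd_iff_eval_eq_zero hn (h.primitive.pow (by positivity) rfl) h.ne_zero
      h.pow_half]
    intro θ hθ
    simpa [wordPolynomial, eval_finsetSum] using hc θ hθ
  have hdeg : (wordPolynomial fun i => algebraMap F L (c i)).degree <
      (X ^ (q ^ 2 + 1) - C (-1 : L)).degree := by
    rw [degree_X_pow_sub_C hn, ← mem_degreeLT]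
    refine Submodule.sum_mem _ fun i _ => ?_
    rw [mem_degreeLT]
    exact (degree_C_mul_X_pow_le _ _).trans_lt (by exact_mod_cast i.2)
  have h0 := eq_zero_of_dvd_of_degree_lt hdvd hdeg
  ext i
  have h1 := congrArg (fun p => p.coeff i) h0
  simpa [wordPolynomial, finsetSum_coeff, coeff_C_mul, coeff_X_pow, Fin.val_inj] using h1

theorem subfieldSubcode_negacyclicFamily [Algebra F K] [IsScalarTower F K L]
    (h : IsOvoidRoot F q δ) (hK : Nat.card K = q ^ 2) :
    subfieldSubcode F (negacyclicFamily K q δ 1 (q ^ 2 - q + 1)) =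
      LinearMap.range (traceWord F (q ^ 2 + 1) δ⁻¹) := by
  classical
  obtain ⟨σ, hσ, -, htr, -⟩ := h.exists_frobenius
  have hmem : ∀ c : Fin (q ^ 2 + 1) → F,
      c ∈ subfieldSubcode F (negacyclicFamily K q δ 1 (q ^ 2 - q + 1)) ↔
      ∀ θ : L, θ ^ (q ^ 2 + 1) = -1 → ¬ (θ = δ ∨ θ = σ δ ∨ θ = σ (σ δ) ∨ θ = σ (σ (σ δ))) →
        ∑ i, algebraMap F L (c i) * θ ^ (i : ℕ) = 0 := by
    intro c
    simp only [IsScalarTower.algebraMap_apply F K L]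
    exact h.mem_negacyclicFamily_iff hK hσ _
  have htrace : ∀ a, traceWord F (q ^ 2 + 1) δ⁻¹ a ∈
      subfieldSubcode F (negacyclicFamily K q δ 1 (q ^ 2 - q + 1)) := by
    intro a
    rw [hmem]
    intro θ hθ hne
    simp only [not_or] at hne
    rw [h.sum_traceWord_mul_pow htr a hθ, if_neg hne.1, if_neg hne.2.1, if_neg hne.2.2.1,
      if_neg hne.2.2.2]
    simp
  refine le_antisymm (fun c hc => ?_) ?_
  -- The trace word of `a` takes the value `a` at `δ`. So its difference from `c` vanishes at `δ`,
  -- then at the conjugates because its coefficients lie in `F`, and at all other roots of `X ^ n +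
  -- 1` by membership.
  · set a := ∑ i, algebraMap F L (c i) * δ ^ (i : ℕ) with ha
    refine ⟨a, (sub_eq_zero.mp (h.eq_zero_of_forall_sum_mul_pow_eq_zero ?_)).symm⟩
    set d : Fin (q ^ 2 + 1) → F := c - traceWord F (q ^ 2 + 1) δ⁻¹ a with hd
    have hsub := (hmem d).mp (Submodule.sub_mem _ hc (htrace a))
    have hδ : ∑ i, algebraMap F L (d i) * δ ^ (i : ℕ) = 0 := by
      simp only [hd, Pi.sub_apply, map_sub, sub_mul]
      obtain ⟨h1, h2, h3⟩ := h.frobenius_iterate_ne hσ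
      rw [Finset.sum_sub_distrib, h.sum_traceWord_mul_pow htr a h.pow_half, if_pos rfl,
        if_neg h1.symm, if_neg h2.symm, if_neg h3.symm, ← ha]
      ring
    have hstep : ∀ θ : L,
        ∑ i, algebraMap F L (d i) * θ ^ (i : ℕ) = 0 →
        ∑ i, algebraMap F L (d i) * σ θ ^ (i : ℕ) = 0 := by
      intro θ hθ
      have := congrArg σ hθ
      rw [map_zero, map_sum] at this
      rw [← this]
      exact Finset.sum_congr rfl fun i _ => by rw [map_mul, map_pow, AlgHom.commutes]
    intro θ hθ
    by_cases hroot : θ = δ ∨ θ = σ δ ∨ θ = σ (σ δ) ∨ θ = σ (σ (σ δ))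
    · rcases hroot with rfl | rfl | rfl | rfl
      · exact hδ
      · exact hstep _ hδ
      · exact hstep _ (hstep _ hδ)
      · exact hstep _ (hstep _ (hstep _ hδ))
    · exact hsub θ hθ hroot
  · rintro _ ⟨a, rfl⟩
    exact htrace a

end IsOvoidRoot

end SubfieldSubcode

theorem theorem5 {F K L : Type*} [Field F] [Field K] [Field L] [DecidableEq F]
    [Algebra F K] [Algebra K L] (q : ℕ) (hq : q % 4 = 3)
    (hF : Nat.card F = q) (hK : Nat.card K = q ^ 2) (hL : Nat.card L = q ^ 4)
    (δ : L) (hδ : IsPrimitiveRoot δ (2 * (q ^ 2 + 1)))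
    (D : Submodule F (Fin (q ^ 2 + 1) → F))
    (hD : D = subfieldSubcode F (negacyclicFamily K q δ 1 (q ^ 2 - q + 1))) :
    IsNegacyclic D ∧
    IsOvoidCode D ∧
    HasParameters D 4 (q ^ 2 - q) ∧
    weightEnumerator D =
      1 + Polynomial.C (((q : ℤ) ^ 2 - q) * ((q : ℤ) ^ 2 + 1)) * Polynomial.X ^ (q ^ 2 - q)
        + Polynomial.C (((q : ℤ) - 1) * ((q : ℤ) ^ 2 + 1)) * Polynomial.X ^ (q ^ 2) ∧
    HasParameters (dualCode D) (q ^ 2 - 3) 4 := by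
  let _ : Algebra F L := ((algebraMap K L).comp (algebraMap F K)).toAlgebra
  have : IsScalarTower F K L := IsScalarTower.of_algebraMap_eq fun _ => rfl
  have h : IsOvoidRoot F q δ := ⟨hq, hF, hL, hδ⟩
  rw [h.subfieldSubcode_negacyclicFamily hK] at hD
  subst hD
  have h' := h.inv
  refine ⟨h'.isNegacyclic_range_traceWord, ⟨hF ▸ h.two_lt, by rw [hF], ?_⟩,
    h'.hasParameters_range_traceWord, h'.weightEnumerator_range_traceWord,
    h'.hasParameters_dualCode_range_traceWord⟩
  rw [hF]
  exact h'.hasParameters_range_traceWord
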